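/- All graphs are finite and simple. Let $P(G,t)$ denote the chromatic polynomial of a graph $G$, i.e. the polynomial whose value at each non-negative integer $n$ is the number of proper $n$-colourings of $G$. The double subdivision of an edge $uv$ of $G$ deletes $uv$, adds two new vertices, and joins both of them to $u$ and to $v$. A generalised triangle is either $K_3$ or any graph obtained from $K_3$ by a sequence of double subdivisions. A $2$-cut of $G$ is a pair of distinct vertices $\{x,y\}$ whose removal increases the number of connected components; its $\{x,y\}$-bridges are the induced subgraphs $G[V(C)\cup\{x,y\}]$, where $C$ ranges over the components of $G-\{x,y\}$, and a bridge is trivial if it has exactly three vertices. Let $\mathcal{K}_2$ be the class of generalised triangles $G$ such that every $2$-cut $\{x,y\}$ of $G$ has at least one trivial $\{x,y\}$-bridge. Let $q\approx 1.225$ be the unique real root of $t^4-4t^3+4t^2-4t+4$ in the interval $(1,2)$. If $G\in\mathcal{K}_2$, then $(-1)^{|V(G)|}P(G,t)>0$ for all $t\in(1,q]$. -/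

import Mathlib

open scoped Polynomial

namespace GenTriangle

universe u

/-! ### The chromatic polynomial -/

/-- The chromatic polynomial of a finite simple graph, as Whitney's sum over the sets `S` of edges
of `(-1) ^ |S| * X ^ c(S)`, where `c(S)` is the number of connected components of the spanning
subgraph with edge set `S`. It counts proper colourings, by `chromaticPolynomial_eval_natCast`. -/
noncomputable def chromaticPolynomial {V : Type u} [Finite V] (G : SimpleGraph V) : ℤ[X] :=
  ∑ S ∈ G.edgeSet.toFinite.toFinset.powerset,
    (-1) ^ S.card *
      Polynomial.X ^ Nat.card (SimpleGraph.fromEdgeSet (S : Set (Sym2 V))).ConnectedComponent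

/-- Functions constant on the components of a graph are functions on the set of components. -/
theorem card_constant_on_components {V : Type u} [Finite V] (H : SimpleGraph V) (n : ℕ) :
    Nat.card {f : V → Fin n // ∀ a b, H.Adj a b → f a = f b} =
      n ^ Nat.card H.ConnectedComponent := by
  have hreach : ∀ f : V → Fin n, (∀ a b, H.Adj a b → f a = f b) →
      ∀ a b, H.Reachable a b → f a = f b := by
    rintro f hf a b ⟨p⟩
    induction p with
    | nil => rfl
    | cons h _ ih => exact (hf _ _ h).trans ih
  let e : {f : V → Fin n // ∀ a b, H.Adj a b → f a = f b} ≃ (H.ConnectedComponent → Fin n) :=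
    { toFun := fun f => Quot.lift f.1 (hreach f.1 f.2)
      invFun := fun g => ⟨fun v => g (H.connectedComponentMk v), fun a b h =>
        congrArg g (SimpleGraph.ConnectedComponent.eq.2 h.reachable)⟩
      left_inv := fun f => rfl
      right_inv := fun g => by
        funext c
        induction c using SimpleGraph.ConnectedComponent.ind
        rfl }
  rw [Nat.card_congr e, Nat.card_fun, Nat.card_fin]

open Classical in
/-- The value of the chromatic polynomial at a natural number `n` is the number of proper
`n`-colourings. -/
theorem chromaticPolynomial_eval_natCast {V : Type u} [Finite V] (G : SimpleGraph V) (n : ℕ) :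
    (chromaticPolynomial G).eval (n : ℤ) = (Nat.card (G.Coloring (Fin n)) : ℤ) := by
  have := Fintype.ofFinite V
  let E : Finset (Sym2 V) := G.edgeSet.toFinite.toFinset
  let mono : (V → Fin n) → Sym2 V → Prop := fun f e => ∀ a ∈ e, ∀ b ∈ e, f a = f b
  have hmono : ∀ (f : V → Fin n) (a b : V), mono f s(a, b) ↔ f a = f b := by
    intro f a b
    simp only [mono, Sym2.mem_iff]
    constructor
    · intro h
      exact h a (Or.inl rfl) b (Or.inr rfl)
    · rintro h x (rfl | rfl) y (rfl | rfl) <;> simp [h]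
  -- the number of colourings as a sum over all functions
  have h1 : (Nat.card (G.Coloring (Fin n)) : ℤ) =
      ∑ f : V → Fin n, ∏ e ∈ E, (1 + (if mono f e then (-1 : ℤ) else 0)) := by
    let eq : G.Coloring (Fin n) ≃ {f : V → Fin n // ∀ e ∈ E, ¬ mono f e} :=
      { toFun := fun c => ⟨c, by
          intro e he
          induction e using Sym2.ind with
          | _ a b =>
            rw [hmono]
            exact c.valid (by simpa [E] using he)⟩
        invFun := fun f => SimpleGraph.Coloring.mk f.1 (by
          intro a b hab
          have := f.2 s(a, b) (by simpa [E] using hab)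
          rwa [hmono] at this)
        left_inv := fun c => rfl
        right_inv := fun f => rfl }
    rw [Nat.card_congr eq, Nat.card_eq_fintype_card, Fintype.card_subtype, Finset.card_filter]
    push_cast
    refine Finset.sum_congr rfl fun f _ => ?_
    split_ifs with h
    · refine (Finset.prod_eq_one fun e he => ?_).symm
      simp [h e he]
    · push Not at h
      obtain ⟨e, he, hm⟩ := h
      exact (Finset.prod_eq_zero he (by simp [hm])).symm
  rw [h1]
  simp only [Finset.prod_one_add]
  rw [Finset.sum_comm]
  simp only [chromaticPolynomial, Polynomial.eval_finsetSum]
  refine Finset.sum_congr rfl fun S _ => ?_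
  have h2 : ∀ f : V → Fin n, (∏ e ∈ S, (if mono f e then (-1 : ℤ) else 0)) =
      if ∀ e ∈ S, mono f e then (-1) ^ S.card else 0 := by
    intro f
    rw [Finset.prod_ite_zero]
    simp
  simp only [h2]
  rw [← Finset.sum_filter, Finset.sum_const, ← Fintype.card_subtype, ← Nat.card_eq_fintype_card]
  have h3 : Nat.card {f : V → Fin n // ∀ e ∈ S, mono f e} =
      n ^ Nat.card (SimpleGraph.fromEdgeSet (S : Set (Sym2 V))).ConnectedComponent := by
    rw [← card_constant_on_components]
    refine Nat.card_congr (Equiv.subtypeEquivRight fun f => ?_)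
    constructor
    · intro h a b hab
      rw [SimpleGraph.fromEdgeSet_adj] at hab
      exact (hmono f a b).1 (h _ (by simpa using hab.1))
    · intro h e he
      induction e using Sym2.ind with
      | _ a b =>
        rw [hmono]
        by_cases hab : a = b
        · rw [hab]
        · exact h a b (by rw [SimpleGraph.fromEdgeSet_adj]; exact ⟨by simpa using he, hab⟩)
  rw [h3]
  simp [mul_comm]

/-! ### Generalised triangles -/

/-- Double subdivision of `G` at `u`, `v` (used for an edge `uv`): delete the edge `uv`, add two
new vertices `Sum.inr 0`, `Sum.inr 1`, and join both of them to `u` and `v`. -/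
def doubleSubdivision {V : Type u} (G : SimpleGraph V) (u v : V) : SimpleGraph (V ⊕ Fin 2) where
  Adj
    | Sum.inl a, Sum.inl b => G.Adj a b ∧ s(a, b) ≠ s(u, v)
    | Sum.inl a, Sum.inr _ => a = u ∨ a = v
    | Sum.inr _, Sum.inl a => a = u ∨ a = v
    | Sum.inr _, Sum.inr _ => False
  symm := ⟨by
    rintro (a | i) (b | j) h
    · exact ⟨h.1.symm, by rw [Sym2.eq_swap]; exact h.2⟩
    · exact h
    · exact h
    · exact h⟩
  loopless := ⟨by
    rintro (a | i) h
    · exact h.1.ne rfl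
    · exact h⟩

/-- Generalised triangles: the graphs isomorphic to `K₃` or to a graph obtained from `K₃` by a
sequence of double subdivisions of edges. -/
inductive IsGeneralisedTriangle : {V : Type u} → SimpleGraph V → Prop
  | triangle {V : Type u} (G : SimpleGraph V)
      (h : Nonempty (G ≃g (⊤ : SimpleGraph (Fin 3)))) : IsGeneralisedTriangle G
  | subdivide {V W : Type u} (H : SimpleGraph V) (G : SimpleGraph W) (u v : V)
      (hH : IsGeneralisedTriangle H) (huv : H.Adj u v)
      (h : Nonempty (G ≃g doubleSubdivision H u v)) : IsGeneralisedTriangle G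

/-! ### 2-cuts and their bridges -/

/-- A cut-set of a (finite) graph: a set of vertices whose removal increases the number of
components. -/
def IsCutSet {V : Type u} (G : SimpleGraph V) (S : Set V) : Prop :=
  Nat.card G.ConnectedComponent < Nat.card (G.induce Sᶜ).ConnectedComponent

/-- `{x, y}` is a 2-cut: a cut-set with exactly two elements. -/
def IsTwoCut {V : Type u} (G : SimpleGraph V) (x y : V) : Prop :=
  x ≠ y ∧ IsCutSet G {x, y}

/-- `B` is an `{x, y}`-bridge of `G`: the subgraph induced on `V(C) ∪ {x, y}` for a component `C`
of `G - {x, y}`. -/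
def IsPairBridge {V : Type u} (G : SimpleGraph V) (x y : V) (B : G.Subgraph) : Prop :=
  ∃ C : (G.induce ({x, y} : Set V)ᶜ).ConnectedComponent,
    B = (⊤ : G.Subgraph).induce (Subtype.val '' C.supp ∪ {x, y})

/-- The pair `{x, y}` has a trivial bridge, that is, a bridge with exactly three vertices. -/
def HasTrivialBridge {V : Type u} (G : SimpleGraph V) (x y : V) : Prop :=
  ∃ B : G.Subgraph, IsPairBridge G x y B ∧ B.verts.ncard = 3

/-- The class `K₂` of generalised triangles in which every 2-cut has a trivial bridge. -/
def ClassK2 {V : Type u} (G : SimpleGraph V) : Prop :=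
  IsGeneralisedTriangle G ∧ ∀ x y : V, IsTwoCut G x y → HasTrivialBridge G x y

/-! ### The constant `q` -/

theorem existsUnique_q :
    ∃! t : ℝ, t ∈ Set.Ioo (1 : ℝ) 2 ∧ t ^ 4 - 4 * t ^ 3 + 4 * t ^ 2 - 4 * t + 4 = 0 := by
  have hc : ContinuousOn (fun t : ℝ => t ^ 4 - 4 * t ^ 3 + 4 * t ^ 2 - 4 * t + 4)
      (Set.Icc 1 2) := by fun_prop
  have hmem : (0 : ℝ) ∈ Set.Ioo ((2 : ℝ) ^ 4 - 4 * 2 ^ 3 + 4 * 2 ^ 2 - 4 * 2 + 4)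
      (1 ^ 4 - 4 * 1 ^ 3 + 4 * 1 ^ 2 - 4 * 1 + 4) := by constructor <;> norm_num
  obtain ⟨t, ht, h0⟩ := intermediate_value_Ioo' (by norm_num : (1 : ℝ) ≤ 2) hc hmem
  refine ⟨t, ⟨ht, h0⟩, ?_⟩
  rintro s ⟨hs, hs0⟩
  have h0' : t ^ 4 - 4 * t ^ 3 + 4 * t ^ 2 - 4 * t + 4 = 0 := h0
  -- with `a = s - 1`, `b = t - 1` the polynomial is `(a ^ 2 - 1) ^ 2 - 4 * a`
  have key : (s - t) * (((s - 1) + (t - 1)) * (2 - (s - 1) ^ 2 - (t - 1) ^ 2) + 4) = 0 := by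
    linear_combination h0' - hs0
  rcases mul_eq_zero.1 key with h | h
  · linarith
  · exfalso
    have ha : 0 < s - 1 := by linarith [hs.1]
    have hb : 0 < t - 1 := by linarith [ht.1]
    have ha1 : (s - 1) ^ 2 < 1 := by nlinarith [hs.2]
    have hb1 : (t - 1) ^ 2 < 1 := by nlinarith [ht.2]
    have : 0 < ((s - 1) + (t - 1)) * (2 - (s - 1) ^ 2 - (t - 1) ^ 2) :=
      mul_pos (by linarith) (by linarith)
    linarith

/-- `q ≈ 1.225`, the unique real root of `t⁴ - 4t³ + 4t² - 4t + 4` in `(1, 2)`. -/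
noncomputable def q : ℝ := Classical.choose existsUnique_q.exists

theorem q_spec : q ∈ Set.Ioo (1 : ℝ) 2 ∧ q ^ 4 - 4 * q ^ 3 + 4 * q ^ 2 - 4 * q + 4 = 0 :=
  Classical.choose_spec existsUnique_q.exists

end GenTriangle

namespace GenTriangle

open Polynomial

universe u

/-! Give every edge two weights, `a` when its ends share a colour and `b` when they differ, and sum
the products of weights over all `n`-colourings; `a = 0`, `b = 1` gives the chromatic polynomial.
Summing over the colours of the two new vertices of a double subdivision leaves the same kind of sum
on the smaller graph, the restored edge carrying new weights that are polynomials in `n`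
(`colourSum_doubleSubdivision`). The total is thus carried unchanged down to a weighted triangle.
Each reduction removes two vertices, so the parity of `|V|` is unchanged, and a negative value is
needed on the triangle.

At `t` the invariant is `b > 0` and `0 ≤ a ≤ c * b`, with `c = (t - 1) / √(3 - t)`. A trivial bridge
at `{u, v}` allows one of the two paths to be taken with `a = 0` on both edges, and then the
restored edge is again admissible exactly because the quartic defining `q` is nonnegative at `t`
(`Admissible.series`). On a triangle admissible weights give a negative value
(`Admissible.triangle`).

The trivial bridges must survive the reductions. Cuts of the smaller graph are cuts of the larger
one, and their trivial bridges avoid the restored edge because the ends of an edge never separate a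
generalised triangle (`TrivialBridges.of_doubleSubdivision`). -/

/-! ### Connectivity after deleting vertices -/

/-- Deleting `R` from `G` leaves a graph with at most one component: every vertex predicate that is
constant along the edges avoiding `R` is constant outside `R`. -/
def ConnectedOff {V : Type u} (G : SimpleGraph V) (R : Set V) : Prop :=
  ∀ p : V → Prop, (∀ v w, v ∉ R → w ∉ R → G.Adj v w → p v → p w) →
    ∀ v w, v ∉ R → w ∉ R → p v → p w

theorem ConnectedOff.of_iso {V W : Type u} {G : SimpleGraph V} {H : SimpleGraph W} (φ : G ≃g H)
    {R : Set V} (h : ConnectedOff H (φ.symm ⁻¹' R)) : ConnectedOff G R := by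
  intro p hp v w hv hw hpv
  have := h (fun x => p (φ.symm x))
    (fun x y hx hy hxy => hp _ _ hx hy (φ.symm.map_adj_iff.2 hxy)) (φ v) (φ w)
    (by simpa using hv) (by simpa using hw) (by simpa using hpv)
  simpa using this

/-- A surviving new vertex `j` replaces the lost edge `uv` by a path of length two, and a surviving
end of `uv` is joined to every new vertex. -/
theorem ConnectedOff.doubleSubdivision {V : Type u} {H : SimpleGraph V} {u v : V}
    {R : Set (V ⊕ Fin 2)} (h : ConnectedOff H (Sum.inl ⁻¹' R))
    (huv : Sum.inl u ∉ R ∨ Sum.inl v ∉ R) {j : Fin 2} (hj : Sum.inr j ∉ R) :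
    ConnectedOff (GenTriangle.doubleSubdivision H u v) R := by
  intro p hp
  have hu : ∀ i, (GenTriangle.doubleSubdivision H u v).Adj (Sum.inl u) (Sum.inr i) :=
    fun i => Or.inl rfl
  have hv : ∀ i, (GenTriangle.doubleSubdivision H u v).Adj (Sum.inl v) (Sum.inr i) :=
    fun i => Or.inr rfl
  have hinl : ∀ x y, Sum.inl x ∉ R → Sum.inl y ∉ R → p (Sum.inl x) → p (Sum.inl y) := by
    refine h (fun x => p (Sum.inl x)) ?_
    intro x y hx hy hxy hpx
    by_cases he : s(x, y) = s(u, v)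
    · rcases Sym2.eq_iff.1 he with ⟨rfl, rfl⟩ | ⟨rfl, rfl⟩
      · exact hp _ _ hj hy (hv j).symm (hp _ _ hx hj (hu j) hpx)
      · exact hp _ _ hj hy (hu j).symm (hp _ _ hx hj (hv j) hpx)
    · exact hp _ _ hx hy ⟨hxy, he⟩ hpx
  obtain ⟨w, hw, hadj⟩ : ∃ w, Sum.inl w ∉ R ∧
      ∀ i, (GenTriangle.doubleSubdivision H u v).Adj (Sum.inl w) (Sum.inr i) := by
    rcases huv with h | h
    · exact ⟨u, h, hu⟩
    · exact ⟨v, h, hv⟩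
  have hto : ∀ x, x ∉ R → p x → p (Sum.inl w) := by
    rintro (x | i) hx hpx
    · exact hinl _ _ hx hw hpx
    · exact hp _ _ hx hw (hadj i).symm hpx
  have hfrom : ∀ x, x ∉ R → p (Sum.inl w) → p x := by
    rintro (x | i) hx hpx
    · exact hinl _ _ hw hx hpx
    · exact hp _ _ hw hx (hadj i) hpx
  exact fun x y hx hy hpx => hfrom y hy (hto x hx hpx)

/-- In a double subdivision an adjacent pair is either an edge of `H` other than `uv`, or an end of
`uv` with a new vertex. Deleting it, like deleting a single vertex, spares some end of `uv` and some
new vertex. -/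
theorem IsGeneralisedTriangle.connectedOff {V : Type u} {G : SimpleGraph V}
    (hG : IsGeneralisedTriangle G) :
    ConnectedOff G ∅ ∧ (∀ x, ConnectedOff G {x}) ∧ ∀ x y, G.Adj x y → ConnectedOff G {x, y} := by
  induction hG with
  | triangle G h =>
    obtain ⟨φ⟩ := h
    have : ∀ R, ConnectedOff G R := by
      intro R p hp v w hv hw hpv
      by_cases hvw : v = w
      · exact hvw ▸ hpv
      · exact hp v w hv hw (φ.map_adj_iff.1 (by simpa using hvw)) hpv
    exact ⟨this _, fun _ => this _, fun _ _ _ => this _⟩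
  | subdivide H G u v hH huv h ih =>
    obtain ⟨φ⟩ := h
    obtain ⟨ih0, ih1, ih2⟩ := ih
    have hne : u ≠ v := huv.ne
    have hfin : ∀ i : Fin 2, ∃ j, j ≠ i := exists_ne
    refine ⟨?_, ?_, ?_⟩
    · refine ConnectedOff.of_iso φ ?_
      exact ConnectedOff.doubleSubdivision (j := 0) (by simpa using ih0) (by simp) (by simp)
    · intro x
      refine ConnectedOff.of_iso φ ?_
      have hx : φ.symm ⁻¹' {x} = {φ x} := by
        ext z; simp [← φ.symm.injective.eq_iff (a := z) (b := φ x)]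
      rw [hx]
      generalize φ x = z
      rcases z with z | i
      · refine ConnectedOff.doubleSubdivision (j := 0) ?_ ?_ (by simp)
        · convert ih1 z using 1
          ext; simp
        · by_contra! hc
          simp at hc
          exact hne (hc.1.trans hc.2.symm)
      · obtain ⟨j, hj⟩ := hfin i
        refine ConnectedOff.doubleSubdivision (j := j) ?_ (by simp) (by simpa using hj)
        convert ih0 using 1
        ext; simp
    · intro x y hxy
      refine ConnectedOff.of_iso φ ?_
      have hx : φ.symm ⁻¹' {x, y} = {φ x, φ y} := by
        ext z
        simp [← φ.symm.injective.eq_iff (a := z)]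
      rw [hx]
      have hxy' := φ.map_adj_iff.2 hxy
      revert hxy'
      generalize φ x = z
      generalize φ y = z'
      revert z z'
      have key : ∀ a (i : Fin 2), a = u ∨ a = v →
          ConnectedOff (doubleSubdivision H u v) {Sum.inl a, Sum.inr i} := by
        intro a i ha
        obtain ⟨j, hj⟩ := hfin i
        refine ConnectedOff.doubleSubdivision (j := j) ?_ ?_ (by simpa using hj)
        · convert ih1 a using 1
          ext; simp
        · by_contra! hc
          simp at hc
          exact hne (hc.1.trans hc.2.symm)
      rintro (a | i) (b | k) hab
      · refine ConnectedOff.doubleSubdivision (j := 0) ?_ ?_ (by simp)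
        · convert ih2 a b hab.1 using 1
          ext; simp
        · by_contra! hc
          simp at hc
          rcases hc with ⟨rfl | rfl, rfl | rfl⟩
          · exact hne rfl
          · exact hab.2 rfl
          · exact hab.2 Sym2.eq_swap
          · exact hne rfl
      · exact key _ _ hab
      · rw [Set.pair_comm]
        exact key _ _ hab
      · exact hab.elim

/-! ### Two-vertex cuts with a trivial bridge -/

/-- Deleting `x` and `y` separates two vertices of `G`. -/
def Separates {V : Type u} (G : SimpleGraph V) (x y : V) : Prop :=
  x ≠ y ∧ ¬ ConnectedOff G {x, y}

/-- Every separating pair `{x, y}` has a trivial bridge whose middle vertex `z` is such that `m`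
vanishes on both edges of the bridge. -/
def TrivialBridges {V : Type u} (G : SimpleGraph V) (m : Sym2 V → ℝ) : Prop :=
  ∀ x y, Separates G x y →
    ∃ z, (∀ w, G.Adj z w ↔ w = x ∨ w = y) ∧ m s(z, x) = 0 ∧ m s(z, y) = 0

theorem ConnectedOff.map_iso {V W : Type u} {G : SimpleGraph V} {H : SimpleGraph W} (φ : G ≃g H)
    {x y : V} (h : ConnectedOff H {φ x, φ y}) : ConnectedOff G {x, y} := by
  refine ConnectedOff.of_iso φ ?_
  convert h using 1
  ext z
  simp [← φ.symm.injective.eq_iff (a := z)]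

theorem TrivialBridges.comap {V W : Type u} {G : SimpleGraph V} {H : SimpleGraph W} (φ : G ≃g H)
    {m : Sym2 W → ℝ} (h : TrivialBridges H m) : TrivialBridges G (fun e => m (e.map φ)) := by
  rintro x y ⟨hxy, hc⟩
  obtain ⟨z, hz, h1, h2⟩ := h (φ x) (φ y)
    ⟨fun h => hxy (φ.injective h), fun h => hc (ConnectedOff.map_iso φ h)⟩
  refine ⟨φ.symm z, fun w => ?_, by simpa using h1, by simpa using h2⟩
  rw [← φ.map_adj_iff, φ.apply_symm_apply, hz, φ.injective.eq_iff, φ.injective.eq_iff]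

theorem connectedOff_of_preconnected {V : Type u} {G : SimpleGraph V} {R : Set V}
    (h : (G.induce Rᶜ).Preconnected) : ConnectedOff G R := by
  intro p hp v w hv hw hpv
  obtain ⟨q⟩ := h ⟨v, hv⟩ ⟨w, hw⟩
  have : ∀ {a b : (Rᶜ : Set V)}, (G.induce Rᶜ).Walk a b → p a → p b := by
    intro a b q
    induction q with
    | nil => exact id
    | @cons a c b h _ ih => exact fun ha => ih (hp _ _ a.2 c.2 h ha)
  exact this q hpv

theorem ConnectedOff.preconnected {V : Type u} {G : SimpleGraph V} (h : ConnectedOff G ∅) :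
    G.Preconnected := fun v w =>
  h (fun x => G.Reachable v x) (fun _ _ _ _ hxy hx => hx.trans hxy.reachable) v w
    (by simp) (by simp) .rfl

theorem Separates.isTwoCut {V : Type u} [Finite V] {G : SimpleGraph V} {x y : V}
    (hG : G.Preconnected) (h : Separates G x y) : IsTwoCut G x y := by
  refine ⟨h.1, ?_⟩
  have h1 : Nat.card G.ConnectedComponent ≤ 1 := by
    rw [Finite.card_le_one_iff_subsingleton]
    exact hG.subsingleton_connectedComponent
  refine h1.trans_lt ?_
  by_contra! hc
  rw [Finite.card_le_one_iff_subsingleton] at hc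
  refine h.2 (connectedOff_of_preconnected fun a b => ?_)
  exact SimpleGraph.ConnectedComponent.eq.1 (Subsingleton.elim _ _)

/-- Otherwise `y` is the only possible neighbour of `z`, and deleting `y` cuts `z` off from `x`,
although there are no cut vertices. -/
theorem IsGeneralisedTriangle.adj_of_separates {V : Type u} {G : SimpleGraph V}
    (hG : IsGeneralisedTriangle G) {x y z : V} (h : Separates G x y) (hzx : z ≠ x) (hzy : z ≠ y)
    (hz : ∀ w, G.Adj z w → w = x ∨ w = y) : G.Adj z x := by
  by_contra hn
  have := hG.connectedOff.2.1 y (fun w => w = z) (by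
    rintro v w - hw hvw rfl
    rcases hz w hvw with rfl | rfl
    · exact (hn hvw).elim
    · exact (hw rfl).elim) z x (by simpa using hzy) (by simpa using h.1) rfl
  exact hzx this.symm

/-- A bridge with three vertices comes from a component with a single vertex, all of whose
neighbours lie in `{x, y}`; the absence of cut vertices makes it adjacent to both. -/
theorem ClassK2.trivialBridges {V : Type u} [Finite V] {G : SimpleGraph V} (hG : ClassK2 G) :
    TrivialBridges G 0 := by
  intro x y h
  obtain ⟨B, ⟨C, rfl⟩, hB⟩ := hG.2 x y (h.isTwoCut hG.1.connectedOff.1.preconnected)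
  rw [SimpleGraph.Subgraph.induce_verts, Set.ncard_union_eq (by
    rw [Set.disjoint_left]
    rintro _ ⟨a, -, rfl⟩
    exact a.2), Set.ncard_pair h.1] at hB
  obtain ⟨z, hz⟩ := Set.ncard_eq_one.1 (show (Subtype.val '' C.supp).ncard = 1 by omega)
  obtain ⟨⟨z', hz'⟩, hzC, rfl⟩ : z ∈ Subtype.val '' C.supp := hz ▸ rfl
  have hzx : z' ≠ x := fun h => hz' (by simp [h])
  have hzy : z' ≠ y := fun h => hz' (by simp [h])
  have hadj : ∀ w, G.Adj z' w → w = x ∨ w = y := by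
    intro w hw
    by_contra hn
    have hwC : w ∈ Subtype.val '' C.supp := by
      refine ⟨⟨w, hn⟩, ?_, rfl⟩
      rw [SimpleGraph.ConnectedComponent.mem_supp_iff] at hzC ⊢
      rw [← hzC]
      exact SimpleGraph.ConnectedComponent.eq.2
        (SimpleGraph.Adj.reachable (G := G.induce _) (u := ⟨w, hn⟩) (v := ⟨z', hz'⟩) hw.symm)
    rw [hz] at hwC
    exact hw.ne hwC.symm
  refine ⟨z', fun w => ⟨hadj w, ?_⟩, rfl, rfl⟩
  rintro (rfl | rfl)
  · exact hG.1.adj_of_separates h hzx hzy hadj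
  · exact hG.1.adj_of_separates (x := w) (y := x) ⟨h.1.symm, by rw [Set.pair_comm]; exact h.2⟩
      hzy hzx fun v hv => (hadj v hv).symm

theorem separates_doubleSubdivision {V : Type u} {H : SimpleGraph V} {u v x y : V}
    (huv : H.Adj u v) (h : Separates H x y) :
    Separates (doubleSubdivision H u v) (Sum.inl x) (Sum.inl y) := by
  refine ⟨fun e => h.1 (Sum.inl_injective e), fun hc => h.2 ?_⟩
  intro p hp a b ha hb hpa
  -- `r` is an end of `uv` that survives, if there is one; giving the new vertices the value `p r`
  -- extends `p` consistently, since `p` agrees at `u` and `v` when both survive.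
  obtain ⟨r, hr⟩ : ∃ r, ∀ w, w ∉ ({x, y} : Set V) → w = u ∨ w = v → (p w ↔ p r) := by
    by_cases hu : u ∈ ({x, y} : Set V)
    · refine ⟨v, ?_⟩
      rintro w hw (rfl | rfl)
      · exact (hw hu).elim
      · rfl
    · refine ⟨u, ?_⟩
      rintro w hw (rfl | rfl)
      · rfl
      · exact ⟨hp _ _ hw hu huv.symm, hp _ _ hu hw huv⟩
  have hmem : ∀ w : V, (Sum.inl w : V ⊕ Fin 2) ∉ ({Sum.inl x, Sum.inl y} : Set (V ⊕ Fin 2)) ↔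
      w ∉ ({x, y} : Set V) := by simp
  refine hc (Sum.elim p fun _ => p r) ?_ (Sum.inl a) (Sum.inl b) ((hmem a).2 ha) ((hmem b).2 hb) hpa
  rintro (w | i) (w' | j) hw hw' hadj hpw
  · exact hp w w' ((hmem w).1 hw) ((hmem w').1 hw') hadj.1 hpw
  · exact (hr w ((hmem w).1 hw) hadj).1 hpw
  · exact (hr w' ((hmem w').1 hw') hadj).2 hpw
  · exact hpw

/-- A double subdivision at `u`, `v` is separated by `u`, `v`. -/
theorem doubleSubdivision_separates {V : Type u} {H : SimpleGraph V} {u v : V} (huv : u ≠ v) :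
    Separates (doubleSubdivision H u v) (Sum.inl u) (Sum.inl v) := by
  refine ⟨fun e => huv (Sum.inl_injective e), fun hc => ?_⟩
  have := hc (fun z => z = Sum.inr 0) ?_ (Sum.inr 0) (Sum.inr 1) (by simp) (by simp) rfl
  · simp at this
  · rintro w (z | j) - hw' hadj rfl
    · rcases hadj with rfl | rfl <;> simp at hw'
    · exact hadj.elim

/-- Trivial bridges are inherited when the double subdivision of an edge is undone. -/
theorem TrivialBridges.of_doubleSubdivision {V : Type u} {H : SimpleGraph V} {u v : V}
    (hH : IsGeneralisedTriangle H) (huv : H.Adj u v) {m : Sym2 (V ⊕ Fin 2) → ℝ} {m' : Sym2 V → ℝ}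
    (hm : ∀ e, e ≠ s(u, v) → m' e = m (e.map Sum.inl))
    (h : TrivialBridges (doubleSubdivision H u v) m) : TrivialBridges H m' := by
  intro x y hxy
  obtain ⟨z | i, hz, h1, h2⟩ := h _ _ (separates_doubleSubdivision huv hxy)
  -- All neighbours of `z` are old vertices, whereas `u` and `v` have new neighbours. So `z` avoids
  -- the edge `uv`, and its edges keep their weights.
  · have hne : z ≠ u ∧ z ≠ v := by
      constructor
      · rintro rfl
        have := (hz (Sum.inr 0)).1 (Or.inl rfl)
        simp at this
      · rintro rfl
        have := (hz (Sum.inr 0)).1 (Or.inr rfl)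
        simp at this
    have hs : ∀ w, s(z, w) ≠ s(u, v) := by
      intro w hw
      rcases Sym2.eq_iff.1 hw with h | h
      · exact hne.1 h.1
      · exact hne.2 h.1
    refine ⟨z, fun w => ?_, ?_, ?_⟩
    · have := hz (Sum.inl w)
      rw [Sum.inl_injective.eq_iff, Sum.inl_injective.eq_iff] at this
      rw [← this]
      exact ⟨fun h => ⟨h, hs w⟩, fun h => h.1⟩
    · rw [hm _ (hs x)]; exact h1
    · rw [hm _ (hs y)]; exact h2
  -- If `z` were a new vertex, `{x, y}` would be `{u, v}`, an edge of `H`, which does not separate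
  -- `H`.
  · have hu := (hz (Sum.inl u)).1 (Or.inl rfl)
    have hv := (hz (Sum.inl v)).1 (Or.inr rfl)
    rw [Sum.inl_injective.eq_iff, Sum.inl_injective.eq_iff] at hu hv
    refine absurd (hH.connectedOff.2.2 x y ?_) hxy.2
    rcases hu with rfl | rfl <;> rcases hv with rfl | rfl
    · exact (huv.ne rfl).elim
    · exact huv
    · exact huv.symm
    · exact (huv.ne rfl).elim

/-- Swapping two vertices with the same neighbours is an automorphism. -/
theorem exists_iso_swap {V : Type u} {G : SimpleGraph V} {z z' : V}
    (h : ∀ w, G.Adj z w ↔ G.Adj z' w) :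
    ∃ φ : G ≃g G, φ z = z' ∧ ∀ w, w ≠ z → w ≠ z' → φ w = w := by
  classical
  have hs : ∀ a w, G.Adj (Equiv.swap z z' a) w ↔ G.Adj a w := by
    intro a w
    rw [Equiv.swap_apply_def]
    split_ifs with h1 h2
    · rw [h1, h]
    · rw [h2, h]
    · rfl
  refine ⟨⟨Equiv.swap z z', ?_⟩, Equiv.swap_apply_left _ _,
    fun w h1 h2 => Equiv.swap_apply_of_ne_of_ne h1 h2⟩
  intro a b
  rw [hs, G.adj_comm, hs, G.adj_comm]

/-! ### Weighted colour sums -/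

/-- The weight of a pair under a colouring: `a` if its ends have the same colour, `b` otherwise. -/
noncomputable def pairWeight {V : Type u} (a b : Sym2 V → ℝ[X]) (n : ℕ) (f : V → Fin n)
    (e : Sym2 V) : ℝ :=
  open Classical in if (e.map f).IsDiag then (a e).eval (n : ℝ) else (b e).eval (n : ℝ)

/-- The sum over all maps `f : V → Fin n` of the product of the weights of the edges of `G`. -/
noncomputable def colourSum {V : Type u} [Fintype V] (G : SimpleGraph V) (a b : Sym2 V → ℝ[X])
    (n : ℕ) : ℝ :=
  open Classical in ∑ f : V → Fin n, ∏ e ∈ G.edgeFinset, pairWeight a b n f e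

theorem colourSum_eq {V : Type u} [Fintype V] [DecidableEq V] (G : SimpleGraph V)
    [Fintype G.edgeSet] (a b : Sym2 V → ℝ[X]) (n : ℕ) :
    colourSum G a b n = ∑ f : V → Fin n, ∏ e ∈ G.edgeFinset, pairWeight a b n f e := by
  unfold colourSum
  congr!

theorem colourSum_iso {V W : Type u} [Fintype V] [Fintype W] {G : SimpleGraph V}
    {H : SimpleGraph W} (φ : G ≃g H) (a b : Sym2 W → ℝ[X]) (n : ℕ) :
    colourSum G (fun e => a (e.map φ)) (fun e => b (e.map φ)) n = colourSum H a b n := by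
  classical
  unfold colourSum
  refine Fintype.sum_equiv (Equiv.arrowCongr φ.toEquiv (Equiv.refl _)) _ _ fun f => ?_
  refine Finset.prod_bij (fun e _ => e.map φ) ?_ ?_ ?_ ?_
  · intro e he
    induction e using Sym2.ind with
    | _ x y => simpa [φ.map_adj_iff] using he
  · intro e _ e' _ h
    exact Sym2.map.injective φ.injective h
  · intro e he
    induction e using Sym2.ind with
    | _ x y =>
      refine ⟨s(φ.symm x, φ.symm y), ?_, by simp⟩
      simpa [φ.symm.map_adj_iff] using he
  · intro e _
    induction e using Sym2.ind with
    | _ x y =>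
      have h : ∀ x, Equiv.arrowCongr φ.toEquiv (Equiv.refl (Fin n)) f (φ x) = f x := fun x =>
        congrArg f (φ.symm_apply_apply x)
      simp only [pairWeight, Sym2.map_mk, h]
      congr

/-- This sums out the middle vertex of a path of length two. Each factor is its `b` plus `a - b`
times an indicator, and the product is expanded. -/
theorem sum_series (n : ℕ) (i j : Fin n) (a₁ b₁ a₂ b₂ : ℝ) :
    ∑ k : Fin n, (if i = k then a₁ else b₁) * (if j = k then a₂ else b₂) =
      if i = j then a₁ * a₂ + (n - 1) * (b₁ * b₂)
      else a₁ * b₂ + b₁ * a₂ + (n - 2) * (b₁ * b₂) := by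
  have h : ∀ k : Fin n, (if i = k then a₁ else b₁) * (if j = k then a₂ else b₂) =
      b₁ * b₂ + (if i = k then (a₁ - b₁) * b₂ else 0) + (if j = k then b₁ * (a₂ - b₂) else 0) +
        (if i = k then (if i = j then (a₁ - b₁) * (a₂ - b₂) else 0) else 0) := by
    intro k
    by_cases h1 : i = k <;> by_cases h2 : j = k
    · subst h1; subst h2; simp; ring
    · subst h1; simp [h2, Ne.symm h2]; ring
    · subst h2; simp [h1]; ring
    · simp [h1, h2]
  simp only [h, Finset.sum_add_distrib, Finset.sum_ite_eq, Finset.mem_univ, if_true,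
    Finset.sum_const, Finset.card_univ, Fintype.card_fin, nsmul_eq_mul]
  split_ifs <;> ring

theorem edgeFinset_doubleSubdivision {V : Type u} [Fintype V] [DecidableEq V] (H : SimpleGraph V)
    (u v : V) [Fintype H.edgeSet] [Fintype (doubleSubdivision H u v).edgeSet] :
    (doubleSubdivision H u v).edgeFinset =
      (H.edgeFinset.erase s(u, v)).image (Sym2.map Sum.inl) ∪
        {s(Sum.inl u, Sum.inr 0), s(Sum.inl v, Sum.inr 0),
          s(Sum.inl u, Sum.inr 1), s(Sum.inl v, Sum.inr 1)} := by
  ext e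
  rw [SimpleGraph.mem_edgeFinset, Finset.mem_union, Finset.mem_image]
  induction e using Sym2.ind with
  | _ x y =>
    have himg : (∃ e ∈ H.edgeFinset.erase s(u, v), Sym2.map Sum.inl e = s(x, y)) ↔
        ∃ a b : V, (H.Adj a b ∧ s(a, b) ≠ s(u, v)) ∧ x = Sum.inl a ∧ y = Sum.inl b := by
      constructor
      · rintro ⟨e, he, hxy⟩
        induction e using Sym2.ind with
        | _ a b =>
          rw [Finset.mem_erase, SimpleGraph.mem_edgeFinset, SimpleGraph.mem_edgeSet] at he
          rcases Sym2.eq_iff.1 hxy with ⟨h1, h2⟩ | ⟨h1, h2⟩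
          · exact ⟨a, b, ⟨he.2, he.1⟩, h1.symm, h2.symm⟩
          · exact ⟨b, a, ⟨he.2.symm, by rw [Sym2.eq_swap]; exact he.1⟩, h2.symm, h1.symm⟩
      · rintro ⟨a, b, ⟨h1, h2⟩, rfl, rfl⟩
        exact ⟨s(a, b), by simpa using ⟨by simpa using h2, h1⟩, rfl⟩
    rw [himg, SimpleGraph.mem_edgeSet]
    rcases x with x | i <;> rcases y with y | j
    · simp [doubleSubdivision]
    · fin_cases j <;> simp [doubleSubdivision]
    · fin_cases i <;> simp [doubleSubdivision]
    · simp [doubleSubdivision]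

/-- With the colours of the old vertices fixed, the sum over the two new colours factors, and by
`sum_series` each factor depends only on whether `u` and `v` agree, just like the weight of an edge
`uv`. -/
theorem colourSum_doubleSubdivision {V : Type u} [Fintype V] {H : SimpleGraph V}
    {u v : V} (huv : H.Adj u v) (a b : Sym2 (V ⊕ Fin 2) → ℝ[X]) (a' b' : Sym2 V → ℝ[X])
    (ha : ∀ e, e ≠ s(u, v) → a' e = a (e.map Sum.inl))
    (hb : ∀ e, e ≠ s(u, v) → b' e = b (e.map Sum.inl))
    (hau : a' s(u, v) = ∏ i : Fin 2,
      (a s(.inl u, .inr i) * a s(.inl v, .inr i) +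
        (X - 1) * (b s(.inl u, .inr i) * b s(.inl v, .inr i))))
    (hbu : b' s(u, v) = ∏ i : Fin 2,
      (a s(.inl u, .inr i) * b s(.inl v, .inr i) + b s(.inl u, .inr i) * a s(.inl v, .inr i) +
        (X - 2) * (b s(.inl u, .inr i) * b s(.inl v, .inr i)))) (n : ℕ) :
    colourSum (doubleSubdivision H u v) a b n = colourSum H a' b' n := by
  classical
  have hne : u ≠ v := huv.ne
  rw [colourSum_eq, colourSum_eq]
  refine (Fintype.sum_equiv (Equiv.sumArrowEquivProdArrow V (Fin 2) (Fin n)) _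
    (fun p => ∏ e ∈ (doubleSubdivision H u v).edgeFinset,
      pairWeight a b n ((Equiv.sumArrowEquivProdArrow V (Fin 2) (Fin n)).symm p) e)
    (fun f => by simp)).trans ?_
  rw [Fintype.sum_prod_type]
  refine Finset.sum_congr rfl fun f _ => ?_
  have hsplit : ∀ g : Fin 2 → Fin n,
      ∏ e ∈ (doubleSubdivision H u v).edgeFinset,
        pairWeight a b n ((Equiv.sumArrowEquivProdArrow V (Fin 2) (Fin n)).symm (f, g)) e =
      (∏ e ∈ H.edgeFinset.erase s(u, v), pairWeight a' b' n f e) *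
        ∏ i : Fin 2, ((if f u = g i then (a s(.inl u, .inr i)).eval (n : ℝ)
            else (b s(.inl u, .inr i)).eval (n : ℝ)) *
          (if f v = g i then (a s(.inl v, .inr i)).eval (n : ℝ)
            else (b s(.inl v, .inr i)).eval (n : ℝ))) := by
    intro g
    rw [edgeFinset_doubleSubdivision, Finset.prod_union, Finset.prod_image]
    · congr 1
      · refine Finset.prod_congr rfl fun e he => ?_
        have he' := (Finset.mem_erase.1 he).1
        rw [pairWeight, pairWeight, ha e he', hb e he', Sym2.map_map]
        rfl
      · rw [Finset.prod_insert (by simp [hne]), Finset.prod_insert (by simp),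
          Finset.prod_insert (by simp [hne]), Finset.prod_singleton, Fin.prod_univ_two]
        simp [pairWeight, Equiv.sumArrowEquivProdArrow]
        ring_nf
    · exact fun _ _ _ _ h => Sym2.map.injective Sum.inl_injective h
    · rw [Finset.disjoint_left]
      intro e he he'
      obtain ⟨e, -, rfl⟩ := Finset.mem_image.1 he
      induction e using Sym2.ind with
      | _ x y => simp at he'
  rw [Finset.sum_congr rfl fun g _ => hsplit g, ← Finset.mul_sum,
    ← Finset.mul_prod_erase H.edgeFinset _ (a := s(u, v)) (by simpa using huv), mul_comm]
  congr 1
  rw [← Fintype.prod_sum (fun (i : Fin 2) (k : Fin n) =>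
    (if f u = k then (a s(.inl u, .inr i)).eval (n : ℝ)
            else (b s(.inl u, .inr i)).eval (n : ℝ)) *
          (if f v = k then (a s(.inl v, .inr i)).eval (n : ℝ)
            else (b s(.inl v, .inr i)).eval (n : ℝ)))]
  simp only [sum_series, pairWeight, Sym2.map_mk, Sym2.mk_isDiag_iff, hau, hbu]
  by_cases h : f u = f v <;> simp [h]

theorem colourSum_triangle {V : Type u} [Fintype V] {G : SimpleGraph V}
    (φ : G ≃g (⊤ : SimpleGraph (Fin 3))) (a b : Sym2 V → ℝ[X]) :
    ∃ e₁ ∈ G.edgeSet, ∃ e₂ ∈ G.edgeSet, ∃ e₃ ∈ G.edgeSet, ∀ n : ℕ, colourSum G a b n =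
      (X * (a e₁ * (a e₂ * a e₃ + (X - 1) * (b e₂ * b e₃)) +
        (X - 1) * (b e₁ * (a e₂ * b e₃ + b e₂ * a e₃ + (X - 2) * (b e₂ * b e₃))))).eval
          (n : ℝ) := by
  classical
  have hadj : ∀ i j : Fin 3, i ≠ j → s(φ.symm i, φ.symm j) ∈ G.edgeSet := fun i j h =>
    φ.symm.map_adj_iff.2 h
  refine ⟨_, hadj 0 1 (by decide), _, hadj 0 2 (by decide), _, hadj 1 2 (by decide), fun n => ?_⟩
  have hE : G.edgeFinset = {s(φ.symm 0, φ.symm 1), s(φ.symm 0, φ.symm 2),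
      s(φ.symm 1, φ.symm 2)} := by
    ext e
    induction e using Sym2.ind with
    | _ x y =>
      obtain ⟨x, rfl⟩ := φ.symm.surjective x
      obtain ⟨y, rfl⟩ := φ.symm.surjective y
      rw [SimpleGraph.mem_edgeFinset, SimpleGraph.mem_edgeSet, φ.symm.map_adj_iff]
      simp only [Finset.mem_insert, Finset.mem_singleton, Sym2.eq_iff, φ.symm.injective.eq_iff,
        SimpleGraph.top_adj]
      decide +revert
  let e : (V → Fin n) ≃ Fin n × Fin n × Fin n :=
    { toFun := fun f => (f (φ.symm 0), f (φ.symm 1), f (φ.symm 2))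
      invFun := fun p x => ![p.1, p.2.1, p.2.2] (φ x)
      left_inv := fun f => by
        funext x
        obtain ⟨i, rfl⟩ := φ.symm.surjective x
        fin_cases i <;> simp
      right_inv := fun p => by simp }
  unfold colourSum
  refine (Fintype.sum_equiv e _ (fun p =>
    (if p.1 = p.2.1 then (a s(φ.symm 0, φ.symm 1)).eval (n : ℝ)
      else (b s(φ.symm 0, φ.symm 1)).eval (n : ℝ)) *
    ((if p.1 = p.2.2 then (a s(φ.symm 0, φ.symm 2)).eval (n : ℝ)
      else (b s(φ.symm 0, φ.symm 2)).eval (n : ℝ)) *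
    (if p.2.1 = p.2.2 then (a s(φ.symm 1, φ.symm 2)).eval (n : ℝ)
      else (b s(φ.symm 1, φ.symm 2)).eval (n : ℝ)))) fun f => ?_).trans ?_
  · rw [hE, Finset.prod_insert (by simp), Finset.prod_insert (by simp), Finset.prod_singleton]
    simp [pairWeight, e]
  · have h : ∀ (i : Fin n) (c d x y : ℝ), ∑ j, (if i = j then c else d) * (if i = j then x else y) =
        c * x + (n - 1) * (d * y) := by
      intro i c d x y
      rw [sum_series, if_pos rfl]
    simp only [Fintype.sum_prod_type]
    change ∑ i, ∑ j, ∑ k, (if i = j then (a s(φ.symm 0, φ.symm 1)).eval (n : ℝ)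
        else (b s(φ.symm 0, φ.symm 1)).eval (n : ℝ)) *
      ((if i = k then (a s(φ.symm 0, φ.symm 2)).eval (n : ℝ)
        else (b s(φ.symm 0, φ.symm 2)).eval (n : ℝ)) *
      (if j = k then (a s(φ.symm 1, φ.symm 2)).eval (n : ℝ)
        else (b s(φ.symm 1, φ.symm 2)).eval (n : ℝ))) = _
    simp only [← Finset.mul_sum, sum_series, h, Finset.sum_const, Finset.card_univ,
      Fintype.card_fin, nsmul_eq_mul]
    simp

/-! ### The sign of the chromatic polynomial -/

/-- The bound that is preserved by the ratio of the two weights of an edge. -/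
noncomputable def ratioBound (t : ℝ) : ℝ := (t - 1) / √(3 - t)

/-- Preserving a ratio bound `c` comes down to `(3 - t) * c ^ 2 - (2 - t) ^ 2 * c + (t - 1) ^ 2 ≤
0`. `ratioBound t` is the geometric mean of the roots in `c`, so it satisfies this once the roots
are real, and the discriminant is the quartic defining `q`. -/
theorem ratioBound_spec {t : ℝ} (ht : t ∈ Set.Ioc (1 : ℝ) q) :
    t < 5 / 4 ∧ (t - 1) ^ 2 + 4 * (t - 1) < 1 ∧ 0 < ratioBound t ∧ ratioBound t < t - 1 ∧
      (3 - t) * ratioBound t ^ 2 = (t - 1) ^ 2 ∧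
      2 * (3 - t) * ratioBound t ≤ (2 - t) ^ 2 := by
  obtain ⟨⟨hq1, hq2⟩, hq⟩ := q_spec
  -- Any bound below `√5 - 1 ≈ 1.236` would do: that is where `(t - 1) ^ 2 + 4 * (t - 1)` reaches
  -- `1`, as the triangle requires.
  have hq4 : q < 123 / 100 := by
    by_contra! hc
    nlinarith [mul_nonneg (sub_nonneg.2 hc) (sub_nonneg.2 hq2.le),
      mul_nonneg (mul_nonneg (sub_nonneg.2 hc) (sub_nonneg.2 hq2.le)) (sub_nonneg.2 hc),
      mul_nonneg (mul_nonneg (sub_nonneg.2 hc) (sub_nonneg.2 hq2.le)) (sub_nonneg.2 hq2.le)]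
  obtain ⟨ht1, htq⟩ := ht
  have hpoly : 0 ≤ t ^ 4 - 4 * t ^ 3 + 4 * t ^ 2 - 4 * t + 4 := by
    have key : (q - t) * (4 + ((q - 1) + (t - 1)) * (2 - (q - 1) ^ 2 - (t - 1) ^ 2)) =
        t ^ 4 - 4 * t ^ 3 + 4 * t ^ 2 - 4 * t + 4 := by
      linear_combination -hq
    rw [← key]
    refine mul_nonneg (by linarith) ?_
    have : 0 ≤ ((q - 1) + (t - 1)) * (2 - (q - 1) ^ 2 - (t - 1) ^ 2) :=
      mul_nonneg (by linarith) (by nlinarith)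
    linarith
  have h3 : 1 < 3 - t := by linarith
  have hs1 : 1 < √(3 - t) := Real.lt_sqrt_of_sq_lt (by linarith)
  have hc0 : 0 < ratioBound t := div_pos (by linarith) (by linarith)
  have hc2 : (3 - t) * ratioBound t ^ 2 = (t - 1) ^ 2 := by
    rw [ratioBound, div_pow, Real.sq_sqrt (by linarith)]
    field_simp
  refine ⟨by linarith, by nlinarith, hc0, div_lt_self (by linarith) hs1, hc2, ?_⟩
  refine abs_le_of_sq_le_sq' ?_ (sq_nonneg _) |>.2
  calc (2 * (3 - t) * ratioBound t) ^ 2 = 4 * (3 - t) * ((3 - t) * ratioBound t ^ 2) := by ring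
    _ = 4 * (3 - t) * (t - 1) ^ 2 := by rw [hc2]
    -- The difference of the two sides is the quartic itself.
    _ ≤ ((2 - t) ^ 2) ^ 2 := by linarith [hpoly]

/-- The weights `a`, `b` of an edge for equal and for distinct colours are admissible. -/
def Admissible (t a b : ℝ) : Prop := 0 < b ∧ 0 ≤ a ∧ a ≤ ratioBound t * b

/-- Indices 3 and 4 belong to the path on which the equal-colour weights vanish, so it contributes
only `(t - 1) * (b₃ * b₄)` and `(t - 2) * (b₃ * b₄)`. The new `b` is positive as a product of two
negative factors, and the ratio is worst when `a₁` and `a₂` attain their bounds. -/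
theorem Admissible.series {t : ℝ} (ht : t ∈ Set.Ioc (1 : ℝ) q) {a₁ b₁ a₂ b₂ : ℝ}
    (h₁ : Admissible t a₁ b₁) (h₂ : Admissible t a₂ b₂) {b₃ b₄ : ℝ} (h₃ : 0 < b₃) (h₄ : 0 < b₄) :
    Admissible t ((t - 1) * (b₃ * b₄) * (a₁ * a₂ + (t - 1) * (b₁ * b₂)))
      ((t - 2) * (b₃ * b₄) * (a₁ * b₂ + b₁ * a₂ + (t - 2) * (b₁ * b₂))) := by
  obtain ⟨ht4, -, hc, hcs, hc2, hc3⟩ := ratioBound_spec ht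
  set c := ratioBound t
  have hs : 0 < t - 1 := sub_pos.2 ht.1
  obtain ⟨hb₁, ha₁, hr₁⟩ := h₁
  obtain ⟨hb₂, ha₂, hr₂⟩ := h₂
  have hB : 0 < b₁ * b₂ := mul_pos hb₁ hb₂
  have hB' : 0 < b₃ * b₄ := mul_pos h₃ h₄
  have h1 : a₁ * b₂ ≤ c * (b₁ * b₂) := by nlinarith
  have h2 : b₁ * a₂ ≤ c * (b₁ * b₂) := by nlinarith
  have h3 : a₁ * a₂ ≤ c ^ 2 * (b₁ * b₂) := by
    calc a₁ * a₂ ≤ (c * b₁) * (c * b₂) := mul_le_mul hr₁ hr₂ ha₂ (by positivity)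
      _ = _ := by ring
  have h5 : 0 < 2 - t - 2 * c := by nlinarith
  have hlow : (2 - t - 2 * c) * (b₁ * b₂) ≤ -(a₁ * b₂ + b₁ * a₂ + (t - 2) * (b₁ * b₂)) := by
    linarith
  have hpos : 0 < (2 - t - 2 * c) * (b₁ * b₂) := mul_pos h5 hB
  refine ⟨?_, by positivity, ?_⟩
  · have := mul_pos (mul_pos (show 0 < 2 - t by linarith) hB') (hpos.trans_le hlow)
    linarith
  · have hkey : (t - 1) * (c ^ 2 + (t - 1)) ≤ c * (2 - t) * (2 - t - 2 * c) := by
      have : c * (2 - t) * (2 - t - 2 * c) - (t - 1) * (c ^ 2 + (t - 1)) =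
          c * ((2 - t) ^ 2 - 2 * (3 - t) * c) := by linear_combination hc2
      have := mul_nonneg hc.le (sub_nonneg.2 hc3)
      linarith
    calc (t - 1) * (b₃ * b₄) * (a₁ * a₂ + (t - 1) * (b₁ * b₂))
        ≤ (t - 1) * (b₃ * b₄) * (c ^ 2 * (b₁ * b₂) + (t - 1) * (b₁ * b₂)) := by gcongr
      _ = (b₃ * b₄) * (b₁ * b₂) * ((t - 1) * (c ^ 2 + (t - 1))) := by ring
      _ ≤ (b₃ * b₄) * (b₁ * b₂) * (c * (2 - t) * (2 - t - 2 * c)) := by gcongr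
      _ = c * (2 - t) * (b₃ * b₄) * ((2 - t - 2 * c) * (b₁ * b₂)) := by ring
      _ ≤ c * (2 - t) * (b₃ * b₄) * (-(a₁ * b₂ + b₁ * a₂ + (t - 2) * (b₁ * b₂))) := by
        have : 0 ≤ c * (2 - t) * (b₃ * b₄) :=
          mul_nonneg (mul_nonneg hc.le (by linarith)) hB'.le
        exact mul_le_mul_of_nonneg_left hlow this
      _ = _ := by ring

/-- The expression increases with each `aᵢ`. The weaker bound `aᵢ ≤ s * bᵢ` with `s = t - 1` already
suffices, giving a positive multiple of `s * (s ^ 2 + 4 * s - 1)`. -/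
theorem Admissible.triangle {t : ℝ} (ht : t ∈ Set.Ioc (1 : ℝ) q) {a₁ b₁ a₂ b₂ a₃ b₃ : ℝ}
    (h₁ : Admissible t a₁ b₁) (h₂ : Admissible t a₂ b₂) (h₃ : Admissible t a₃ b₃) :
    t * (a₁ * (a₂ * a₃ + (t - 1) * (b₂ * b₃)) +
      (t - 1) * (b₁ * (a₂ * b₃ + b₂ * a₃ + (t - 2) * (b₂ * b₃)))) < 0 := by
  obtain ⟨ht4, hs4, hc, hcs, -, -⟩ := ratioBound_spec ht
  have hs : 0 < t - 1 := sub_pos.2 ht.1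
  have weaken : ∀ {a b}, Admissible t a b → 0 < b ∧ 0 ≤ a ∧ a ≤ (t - 1) * b := fun h =>
    ⟨h.1, h.2.1, h.2.2.trans (mul_le_mul_of_nonneg_right hcs.le h.1.le)⟩
  obtain ⟨hb₁, ha₁, hr₁⟩ := weaken h₁
  obtain ⟨hb₂, ha₂, hr₂⟩ := weaken h₂
  obtain ⟨hb₃, ha₃, hr₃⟩ := weaken h₃
  refine mul_neg_of_pos_of_neg (by linarith) ?_
  have e : t - 2 = (t - 1) - 1 := by ring
  generalize t - 1 = s at *
  have hB : 0 < b₁ * b₂ * b₃ := by positivity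
  calc a₁ * (a₂ * a₃ + s * (b₂ * b₃)) + s * (b₁ * (a₂ * b₃ + b₂ * a₃ + (t - 2) * (b₂ * b₃)))
      ≤ (s * b₁) * ((s * b₂) * (s * b₃) + s * (b₂ * b₃)) +
        s * (b₁ * ((s * b₂) * b₃ + b₂ * (s * b₃) + (t - 2) * (b₂ * b₃))) := by gcongr
    _ = (b₁ * b₂ * b₃) * s * (s ^ 2 + 4 * s - 1) := by rw [e]; ring
    _ < 0 := mul_neg_of_pos_of_neg (by positivity) (by linarith)

/-- Every polynomial interpolating a colour sum of `G` has the sign `(-1) ^ |V|` at `t`, provided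
the weights of the edges are admissible at `t` and every separating pair of vertices has a trivial
bridge on whose edges the weight for equal colours vanishes at `t`. -/
def HasSign {V : Type u} (G : SimpleGraph V) (t : ℝ) : Prop :=
  ∀ [Fintype V] (a b : Sym2 V → ℝ[X]) (p : ℝ[X]), (∀ n : ℕ, p.eval (n : ℝ) = colourSum G a b n) →
    (∀ e ∈ G.edgeSet, Admissible t ((a e).eval t) ((b e).eval t)) →
    TrivialBridges G (fun e => (a e).eval t) → 0 < (-1) ^ Fintype.card V * p.eval t

theorem HasSign.iso {V W : Type u} {G : SimpleGraph V} {H : SimpleGraph W} (φ : G ≃g H) {t : ℝ}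
    (h : HasSign G t) : HasSign H t := by
  intro _ a b p hp hab htr
  have := Fintype.ofEquiv W φ.symm.toEquiv
  rw [← Fintype.card_congr φ.toEquiv]
  refine h (fun e => a (e.map φ)) (fun e => b (e.map φ)) p ?_ ?_ ?_
  · intro n
    rw [hp, colourSum_iso φ]
  · intro e he
    refine hab _ ?_
    induction e using Sym2.ind with
    | _ x y => exact φ.map_adj_iff.2 he
  · exact htr.comap φ

theorem eq_of_eval_natCast_eq {p r : ℝ[X]} (h : ∀ n : ℕ, p.eval (n : ℝ) = r.eval (n : ℝ)) :
    p = r := by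
  refine Polynomial.eq_of_infinite_eval_eq p r (Set.infinite_of_injective_forall_mem
    (f := fun n : ℕ => (n : ℝ)) Nat.cast_injective h)

theorem hasSign_triangle {V : Type u} {G : SimpleGraph V} (φ : G ≃g (⊤ : SimpleGraph (Fin 3)))
    {t : ℝ} (ht : t ∈ Set.Ioc (1 : ℝ) q) : HasSign G t := by
  intro _ a b p hp hab _
  obtain ⟨e₁, h₁, e₂, h₂, e₃, h₃, h⟩ := colourSum_triangle φ a b
  rw [eq_of_eval_natCast_eq fun n => (hp n).trans (h n), Fintype.card_congr φ.toEquiv]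
  have := Admissible.triangle ht (hab _ h₁) (hab _ h₂) (hab _ h₃)
  simp only [eval_mul, eval_add, eval_sub, eval_X, eval_one, eval_ofNat, Fintype.card_fin]
  linarith

/-- The same `p` interpolates the colour sum of `H` with the reduced weights, so the sign passes
over directly from `H`. Here the path through the new vertex `0` is the one with vanishing
equal-colour weights. -/
theorem hasSign_doubleSubdivision {V : Type u} {H : SimpleGraph V} (hH : IsGeneralisedTriangle H)
    {u v : V} (huv : H.Adj u v) {t : ℝ} (ht : t ∈ Set.Ioc (1 : ℝ) q) (h : HasSign H t)
    [Fintype V] (a b : Sym2 (V ⊕ Fin 2) → ℝ[X]) (p : ℝ[X])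
    (hp : ∀ n : ℕ, p.eval (n : ℝ) = colourSum (doubleSubdivision H u v) a b n)
    (hab : ∀ e ∈ (doubleSubdivision H u v).edgeSet, Admissible t ((a e).eval t) ((b e).eval t))
    (htr : TrivialBridges (doubleSubdivision H u v) (fun e => (a e).eval t))
    (hu : (a s(.inl u, .inr 0)).eval t = 0) (hv : (a s(.inl v, .inr 0)).eval t = 0) :
    0 < (-1) ^ Fintype.card (V ⊕ Fin 2) * p.eval t := by
  classical
  let α : ℝ[X] := ∏ i : Fin 2, (a s(.inl u, .inr i) * a s(.inl v, .inr i) +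
        (X - 1) * (b s(.inl u, .inr i) * b s(.inl v, .inr i)))
  let β : ℝ[X] := ∏ i : Fin 2,
    (a s(.inl u, .inr i) * b s(.inl v, .inr i) + b s(.inl u, .inr i) * a s(.inl v, .inr i) +
        (X - 2) * (b s(.inl u, .inr i) * b s(.inl v, .inr i)))
  let a' : Sym2 V → ℝ[X] := fun e => if e = s(u, v) then α else a (e.map Sum.inl)
  let b' : Sym2 V → ℝ[X] := fun e => if e = s(u, v) then β else b (e.map Sum.inl)
  have ha' : ∀ e, e ≠ s(u, v) → a' e = a (e.map Sum.inl) := fun e he => if_neg he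
  have hb' : ∀ e, e ≠ s(u, v) → b' e = b (e.map Sum.inl) := fun e he => if_neg he
  have hcard : (-1 : ℝ) ^ Fintype.card (V ⊕ Fin 2) = (-1) ^ Fintype.card V := by
    rw [Fintype.card_sum, Fintype.card_fin, pow_add]
    norm_num
  rw [hcard]
  have hur : ∀ i, Admissible t ((a s(.inl u, .inr i)).eval t) ((b s(.inl u, .inr i)).eval t) :=
    fun i => hab _ (Or.inl rfl)
  have hvr : ∀ i, Admissible t ((a s(.inl v, .inr i)).eval t) ((b s(.inl v, .inr i)).eval t) :=
    fun i => hab _ (Or.inr rfl)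
  refine h a' b' p (fun n => ?_) (fun e he => ?_) ?_
  · rw [hp, colourSum_doubleSubdivision huv a b a' b' ha' hb' (if_pos rfl) (if_pos rfl)]
  · by_cases huve : e = s(u, v)
    · subst huve
      have := Admissible.series ht (hur 1) (hvr 1) (hur 0).1 (hvr 0).1
      simp only [a', b', if_true, α, β, Fin.prod_univ_two, eval_mul, eval_add, eval_sub, eval_X,
        eval_one, eval_ofNat, hu, hv, zero_mul, mul_zero, zero_add]
      exact this
    · rw [ha' e huve, hb' e huve]
      refine hab _ ?_
      induction e using Sym2.ind with
      | _ x y => exact ⟨he, huve⟩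
  · refine TrivialBridges.of_doubleSubdivision hH huv (fun e he => ?_) htr
    rw [ha' e he]

theorem IsGeneralisedTriangle.hasSign {V : Type u} {G : SimpleGraph V}
    (hG : IsGeneralisedTriangle G) {t : ℝ} (ht : t ∈ Set.Ioc (1 : ℝ) q) : HasSign G t := by
  induction hG with
  | triangle G h => exact hasSign_triangle h.some ht
  | @subdivide V W H G u v hH huv h ih =>
    refine HasSign.iso h.some.symm ?_
    intro inst a b p hp hab htr
    have : Finite V := Finite.of_injective (Sum.inl : V → V ⊕ Fin 2) Sum.inl_injective
    have := Fintype.ofFinite V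
    obtain rfl : inst = instFintypeSum V (Fin 2) := Subsingleton.elim _ _
    -- The middle vertex `z` of the trivial bridge at `{u, v}` may be either new vertex or an old
    -- one. It has the same neighbours as the new vertex `0`, so an automorphism exchanging them
    -- moves the vanishing weights to the path through `0`.
    obtain ⟨z, hz, hzu, hzv⟩ := htr _ _ (doubleSubdivision_separates huv.ne)
    obtain ⟨φ, hφ, hfix⟩ := exists_iso_swap (G := doubleSubdivision H u v)
      (z := Sum.inr 0) (z' := z) (fun w => by
        rw [hz]
        rcases w with w | i <;> simp [doubleSubdivision])
    have hφl : ∀ w, w = u ∨ w = v → φ (Sum.inl w) = Sum.inl w := fun w hw =>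
      hfix _ (by simp) ((hz _).2 (by simpa using hw)).ne.symm
    refine hasSign_doubleSubdivision hH huv ht ih (fun e => a (e.map φ)) (fun e => b (e.map φ)) p
      (fun n => (hp n).trans (colourSum_iso φ a b n).symm) (fun e he => hab _ ?_) ?_ ?_ ?_
    · induction e using Sym2.ind with
      | _ x y => exact φ.map_adj_iff.2 he
    · exact htr.comap φ
    · rw [Sym2.map_mk, hφ, hφl u (Or.inl rfl), Sym2.eq_swap]
      exact hzu
    · rw [Sym2.map_mk, hφ, hφl v (Or.inr rfl), Sym2.eq_swap]
      exact hzv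

theorem eval_chromaticPolynomial_natCast {V : Type u} [Fintype V] (G : SimpleGraph V) (n : ℕ) :
    ((chromaticPolynomial G).map (Int.castRingHom ℝ)).eval (n : ℝ) = colourSum G 0 1 n := by
  classical
  have h := congrArg (Int.cast : ℤ → ℝ) (chromaticPolynomial_eval_natCast G n)
  have h0 : ((chromaticPolynomial G).map (Int.castRingHom ℝ)).eval (n : ℝ) =
      (((chromaticPolynomial G).eval (n : ℤ) : ℤ) : ℝ) := by
    simp
  rw [h0, h]
  let e : G.Coloring (Fin n) ≃ {f : V → Fin n // ∀ e ∈ G.edgeFinset, ¬ (e.map f).IsDiag} :=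
    { toFun := fun c => ⟨c, by
        intro e he
        induction e using Sym2.ind with
        | _ x y => exact c.valid (by simpa using he)⟩
      invFun := fun f => SimpleGraph.Coloring.mk f.1 (by
        intro x y hxy
        simpa using f.2 s(x, y) (by simpa using hxy))
      left_inv := fun c => rfl
      right_inv := fun f => rfl }
  rw [Nat.card_congr e, Nat.card_eq_fintype_card, Fintype.card_subtype, Finset.card_filter,
    colourSum]
  push_cast
  refine Finset.sum_congr rfl fun f _ => ?_
  split_ifs with hf
  · refine (Finset.prod_eq_one fun e he => ?_).symm
    simp [pairWeight, hf e he]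
  · push Not at hf
    obtain ⟨e, he, hm⟩ := hf
    exact (Finset.prod_eq_zero he (by simp [pairWeight, hm])).symm

end GenTriangle

theorem lemma17 {V : Type*} [Finite V] (G : SimpleGraph V) (hG : GenTriangle.ClassK2 G)
    (t : ℝ) (ht : t ∈ Set.Ioc (1 : ℝ) GenTriangle.q) :
    0 < (-1 : ℝ) ^ Nat.card V * Polynomial.aeval t (GenTriangle.chromaticPolynomial G) := by
  have := Fintype.ofFinite V
  have h := hG.1.hasSign ht 0 1 _ (GenTriangle.eval_chromaticPolynomial_natCast G)
    (fun e _ => ⟨by simp, by simp, by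
      simpa using (GenTriangle.ratioBound_spec ht).2.2.1.le⟩)
    (by convert hG.trivialBridges using 2; simp)
  rw [Nat.card_eq_fintype_card, Polynomial.aeval_def, ← Polynomial.eval_map]
  exact h
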